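/- **Setting.** Let $\sigma_1=|0\rangle\langle 1|+|1\rangle\langle 0|$ and $\sigma_3=|0\rangle\langle 0|-|1\rangle\langle 1|$. An operator is called real if all its entries in the standard basis are real. Let $\rho_{AB}$ be a real two-qubit density operator on $\mathbb{C}^2\otimes\mathbb{C}^2$. For $\theta\in\mathbb{R}$ let $|\theta\rangle=\cos\frac\theta2|0\rangle+\sin\frac\theta2|1\rangle$ and $$\tilde\rho_B(\theta)=\mathrm{Tr}_A\big[(|\theta\rangle\langle\theta|\otimes\mathbb{I}_B)\rho_{AB}\big].$$ The steering ellipse of $\rho_{AB}$ is $\{\tilde\rho_B(\theta)\mid\theta\in\mathbb{R}\}$, a subset of the three-dimensional real space of real Hermitian operators on $\mathbb{C}^2$ with the inner product $\mathrm{Tr}(X^\dagger Y)$. The tilt of $\lambda=\frac12(n\mathbb{I}+r_1\sigma_1+r_3\sigma_3)$ with $n,r_1,r_3\in\mathbb{R}$ is $\sqrt{r_1^2+r_3^2}/|n|$, and $\infty$ if $n=0$. The tilt of the steering ellipse is the tilt of any nonzero real Hermitian operator that is normal to its affine span if this span is two-dimensional, and $\infty$ otherwise. Let $\mathbb{RP}^1$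 be the set of real one-dimensional orthogonal projectors on $\mathbb{C}^2$. Write $|Z|=\sqrt{Z^\dagger Z}$, $|X|_Y=Y^{-1}|YXY|Y^{-1}$ for invertible Hermitian $Y$, $\langle X\rangle=X/\mathrm{Tr}(X)$ if $\mathrm{Tr}(X)\ne0$, and $\widehat P$ for the adjugate matrix of $P$. **Theorem.** Suppose that the steering ellipse of $\rho_{AB}$ has tilt less than $1$, and let $P\in\mathbb{RP}^1$. Then, for every positive definite density operator $Y$ on $\mathbb{C}^2$, the integral $\int_0^{2\pi}\big|\frac{\mathrm{d}}{\mathrm{d}\theta}\tilde\rho_B(\theta)\big|_Y\,\mathrm{d}\theta$ exists and has nonzero trace, and $$\lim_{Y\to P}\left\langle\int_0^{2\pi}\left|\frac{\mathrm{d}}{\mathrm{d}\theta}\tilde\rho_B(\theta)\right|_Y\mathrm{d}\theta\right\rangle=\widehat P=\mathbb{I}-P,$$ where the limit is taken over all positive definite density operators $Y$ on $\mathbb{C}^2$. -/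

import Mathlib

namespace Steering

noncomputable section

open scoped MatrixOrder ComplexOrder Kronecker ENNReal

/-- Operators on a single qubit `ℂ²`, in the standard basis `|0⟩, |1⟩`. -/
abbrev Op : Type := Matrix (Fin 2) (Fin 2) ℂ

/-- Operators on the two-qubit space `ℂ² ⊗ ℂ²`; the first index is Alice's, the second Bob's. -/
abbrev Op₂ : Type := Matrix (Fin 2 × Fin 2) (Fin 2 × Fin 2) ℂ

/-- A real operator: all entries in the standard basis are real. -/
def IsRealOp {ι : Type*} (X : Matrix ι ι ℂ) : Prop := ∀ i j, (X i j).im = 0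

/-- Density operators: positive semidefinite of trace one. -/
def density (ι : Type*) [Fintype ι] : Set (Matrix ι ι ℂ) :=
  {X | X.PosSemidef ∧ X.trace = 1}

/-- Positive definite density operators. -/
def posDefDensity (ι : Type*) [Fintype ι] : Set (Matrix ι ι ℂ) :=
  {X | X.PosDef ∧ X.trace = 1}

/-- Real density operators. -/
def realDensity (ι : Type*) [Fintype ι] : Set (Matrix ι ι ℂ) :=
  {X | X ∈ density ι ∧ IsRealOp X}

/-- Real one-dimensional orthogonal projectors on `ℂ²`. -/
def RP1 : Set Op := {P | IsStarProjection P ∧ P.rank = 1 ∧ IsRealOp P}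

/-- The Pauli operator `σ₁ = |0⟩⟨1| + |1⟩⟨0|`. -/
def σ₁ : Op := !![0, 1; 1, 0]

/-- The Pauli operator `σ₃ = |0⟩⟨0| - |1⟩⟨1|`. -/
def σ₃ : Op := !![1, 0; 0, -1]

/-- The tilt of a real Hermitian `N = (n I + r₁ σ₁ + r₃ σ₃) / 2`, that is `√(r₁² + r₃²) / |n|`,
and `∞` if `n = 0`; here `n = Tr N`, `r₁ = Tr (N σ₁)` and `r₃ = Tr (N σ₃)`. -/
def tilt (N : Op) : ℝ≥0∞ :=
  if N.trace.re = 0 then ⊤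
  else ENNReal.ofReal
    (√((N * σ₁).trace.re ^ 2 + (N * σ₃).trace.re ^ 2) / |N.trace.re|)

/-- The vector `|θ⟩ = cos (θ/2) |0⟩ + sin (θ/2) |1⟩`. -/
def ket (θ : ℝ) : Fin 2 → ℂ := ![(Real.cos (θ / 2) : ℂ), (Real.sin (θ / 2) : ℂ)]

/-- The projector `|θ⟩⟨θ|`. -/
def proj (θ : ℝ) : Op := Matrix.vecMulVec (ket θ) (star (ket θ))

/-- Partial trace over Alice's qubit. -/
def traceA (M : Op₂) : Op := Matrix.of fun b b' => ∑ a, M (a, b) (a, b')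

/-- Bob's subnormalized state `Tr_A ((|θ⟩⟨θ| ⊗ I) ρ)`. -/
def steered (ρ : Op₂) (θ : ℝ) : Op := traceA ((proj θ ⊗ₖ (1 : Op)) * ρ)

/-- The derivative `dρ̃_B/dθ`, taken entry by entry. -/
def steeredDeriv (ρ : Op₂) (θ : ℝ) : Op :=
  Matrix.of fun i j => deriv (fun t => steered ρ t i j) θ

/-- The steering ellipse of `ρ`, as a subset of the space of operators. -/
def ellipse (ρ : Op₂) : Set Op := Set.range (steered ρ)

/-- Nonzero real Hermitian operators that are normal, for the inner product
`⟨X, Y⟩ = Tr (X† Y)`, to the affine span of `S`. -/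
def normals (S : Set Op) : Set Op :=
  {N | N ≠ 0 ∧ N.IsHermitian ∧ IsRealOp N ∧
    ∀ v ∈ (affineSpan ℝ S).direction, (N.conjTranspose * v).trace = 0}

open scoped Classical in
/-- The tilt of the steering ellipse of `ρ`: the tilt of any nonzero normal to its affine span if
that span is two-dimensional, and `∞` otherwise. The real Hermitian operators form a real space
of dimension three, so in the first case the normals are the nonzero multiples of one operator;
they all have the same tilt, and the infimum is that common value. -/
def steeringTilt (ρ : Op₂) : ℝ≥0∞ :=
  if Module.finrank ℝ (affineSpan ℝ (ellipse ρ)).direction = 2 then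
    ⨅ N ∈ normals (ellipse ρ), tilt N
  else ⊤

/-- `|X|_Y = Y⁻¹ |Y X Y| Y⁻¹`, where `|Z| = √(Z† Z)`. -/
def absRel (Y X : Op) : Op := Y⁻¹ * CFC.abs (Y * X * Y) * Y⁻¹

/-- The operator `∫₀^{2π} |dρ̃_B/dθ|_Y dθ`; the integral is taken entry by entry. -/
def steeringOperator (ρ : Op₂) (Y : Op) : Op :=
  Matrix.of fun i j => ∫ θ in (0 : ℝ)..(2 * Real.pi), absRel Y (steeredDeriv ρ θ) i j

/-- The normalization `⟨X⟩ = X / Tr X`. -/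
def normalized (X : Op) : Op := (X.trace)⁻¹ • X

end

end Steering

namespace Steering

open scoped MatrixOrder ComplexOrder Kronecker ENNReal
open Matrix Filter Topology

/-! Write `X` for the derivative of the steered state and `D = √(tr(Y²X)² - 4 det(Y)² det X)`. Tilt
below one means that the ellipse has a definite normal; `X` is nonzero and orthogonal to it, so `det
X < 0` for every angle (`steeredDeriv_det_neg`). For indefinite `X`, Cayley–Hamilton gives a closed
form (`absRel_eq`): `|X|_Y = (tr(Y²X)/D) X + (-2 det X/D) Ŷ²`. The first coefficient has modulus at
most one, so its contribution to the integral stays bounded as `Y` varies. In the second, `det Y →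
0` as `Y → P`, so `D` tends to `|tr(P²X)|`, the modulus of a sinusoid in the angle. It has a zero,
near which `1/D` dominates the reciprocal of an affine function with vanishing constant term, so the
integral diverges at least logarithmically (`tendsto_integral_divergentCoeff`). After normalization
only the direction `Ŷ²` survives, and it tends to `P̂² = P̂`, which has trace one. -/

/-! ### Cayley–Hamilton and the absolute value of a 2 × 2 matrix -/

lemma mul_self_fin_two (A : Op) : A * A = A.trace • A - A.det • (1 : Op) := by
  ext i j
  fin_cases i <;> fin_cases j <;>
    simp [Matrix.mul_apply, Fin.sum_univ_two, Matrix.trace_fin_two, Matrix.det_fin_two] <;> ring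

lemma adjugate_eq_trace_sub (A : Op) : A.adjugate = A.trace • (1 : Op) - A := by
  ext i j
  fin_cases i <;> fin_cases j <;>
    simp [Matrix.adjugate_fin_two, Matrix.trace_fin_two]

lemma trace_mul_self (A : Op) : (A * A).trace = A.trace ^ 2 - 2 * A.det := by
  rw [mul_self_fin_two]
  simp [Matrix.trace_fin_two, Matrix.det_fin_two]
  ring

lemma IsHermitian.trace_ofReal {A : Op} (hA : A.IsHermitian) : ((A.trace.re : ℝ) : ℂ) = A.trace := by
  have h : star A.trace = A.trace := by rw [← Matrix.trace_conjTranspose, hA.eq]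
  exact Complex.conj_eq_iff_re.1 h

lemma IsHermitian.det_ofReal {A : Op} (hA : A.IsHermitian) : ((A.det.re : ℝ) : ℂ) = A.det := by
  have h : star A.det = A.det := by rw [← Matrix.det_conjTranspose, hA.eq]
  exact Complex.conj_eq_iff_re.1 h

/-- The absolute value of an indefinite Hermitian `2 × 2` matrix. -/
lemma sqrt_smul_abs {Z : Op} (hZ : Z.IsHermitian) (hdet : Z.det.re < 0) :
    ((√(Z.trace.re ^ 2 - 4 * Z.det.re) : ℝ) : ℂ) • CFC.abs Z
      = Z.trace • Z - (2 * Z.det) • (1 : Op) := by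
  set A := CFC.abs Z with hAdef
  have hA : A.PosSemidef := Matrix.nonneg_iff_posSemidef.1 (CFC.abs_nonneg Z)
  have hAA : A * A = Z * Z := by
    rw [hAdef, CFC.abs_mul_abs, Matrix.star_eq_conjTranspose, hZ.eq]
  -- The determinants agree up to sign; positivity of `A` selects the sign opposite to that of `det
  -- Z`.
  have hdetA : A.det.re = -Z.det.re := by
    have h1 : A.det.re * A.det.re = Z.det.re * Z.det.re := by
      have := congrArg Matrix.det hAA
      rw [Matrix.det_mul, Matrix.det_mul, ← IsHermitian.det_ofReal hA.1,
        ← IsHermitian.det_ofReal hZ] at this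
      exact_mod_cast this
    have h2 : 0 ≤ A.det.re := (Complex.nonneg_iff.1 hA.det_nonneg).1
    rcases mul_self_eq_mul_self_iff.1 h1 with h | h
    · linarith
    · exact h
  have hdetA' : A.det = -Z.det := by
    rw [← IsHermitian.det_ofReal hA.1, hdetA, ← IsHermitian.det_ofReal hZ]
    simp
  have htr : A.trace.re ^ 2 = Z.trace.re ^ 2 - 4 * Z.det.re := by
    have := congrArg Matrix.trace hAA
    rw [trace_mul_self, trace_mul_self, hdetA', ← IsHermitian.det_ofReal hZ,
      ← IsHermitian.trace_ofReal hA.1, ← IsHermitian.trace_ofReal hZ] at this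
    have h' : A.trace.re ^ 2 - 2 * -Z.det.re = Z.trace.re ^ 2 - 2 * Z.det.re := by
      exact_mod_cast this
    linarith
  have hnn : 0 ≤ A.trace.re := (Complex.nonneg_iff.1 hA.trace_nonneg).1
  rw [← htr, Real.sqrt_sq hnn, IsHermitian.trace_ofReal hA.1]
  -- Cayley–Hamilton on both sides of `A² = Z²`, with `det A = -det Z`, is linear in `A`.
  have h1 := mul_self_fin_two A
  rw [hAA, mul_self_fin_two Z, hdetA', neg_smul, sub_neg_eq_add] at h1
  rw [two_mul, add_smul, ← sub_sub, h1, add_sub_cancel_right]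

/-! ### The relative absolute value -/

/-- The denominator in the explicit formula for `|X|_Y`. -/
noncomputable def absRelDenom (Y X : Op) : ℝ :=
  √((Y * Y * X).trace.re ^ 2 - 4 * (Y.det.re ^ 2 * X.det.re))

lemma isHermitian_conj {Y X : Op} (hY : Y.IsHermitian) (hX : X.IsHermitian) :
    (Y * X * Y).IsHermitian := by
  have := Matrix.isHermitian_mul_mul_conjTranspose Y hX
  rwa [hY.eq] at this

lemma trace_conj (Y X : Op) : (Y * X * Y).trace = (Y * Y * X).trace := by
  rw [Matrix.trace_mul_comm, Matrix.mul_assoc]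

lemma det_conj {Y : Op} (hY : Y.IsHermitian) {X : Op} (hX : X.IsHermitian) :
    (Y * X * Y).det.re = Y.det.re ^ 2 * X.det.re := by
  rw [Matrix.det_mul, Matrix.det_mul, ← IsHermitian.det_ofReal hY, ← IsHermitian.det_ofReal hX]
  norm_cast
  ring

lemma det_re_pos {Y : Op} (hY : Y.PosDef) : 0 < Y.det.re :=
  (Complex.pos_iff.1 hY.det_pos).1

lemma absRelDenom_pos {Y X : Op} (hY : Y.PosDef) (hdet : X.det.re < 0) :
    0 < absRelDenom Y X := by
  have := det_re_pos hY
  refine Real.sqrt_pos.2 ?_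
  have h : Y.det.re ^ 2 * X.det.re < 0 := mul_neg_of_pos_of_neg (by positivity) hdet
  nlinarith [sq_nonneg (Y * Y * X).trace.re]

/-- An explicit formula for `|X|_Y` when `X` is indefinite. -/
lemma absRel_eq {Y X : Op} (hY : Y.PosDef) (hX : X.IsHermitian) (hdet : X.det.re < 0) :
    absRel Y X = (((Y * Y * X).trace.re / absRelDenom Y X : ℝ) : ℂ) • X
      + ((-2 * X.det.re / absRelDenom Y X : ℝ) : ℂ) • (Y.adjugate * Y.adjugate) := by
  have hs := absRelDenom_pos hY hdet
  have hy := det_re_pos hY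
  have hsC : ((absRelDenom Y X : ℝ) : ℂ) ≠ 0 := by exact_mod_cast hs.ne'
  have hZ := isHermitian_conj hY.1 hX
  have hZdet : (Y * X * Y).det.re < 0 := by
    rw [det_conj hY.1 hX]; exact mul_neg_of_pos_of_neg (by positivity) hdet
  have hYu : IsUnit Y.det := isUnit_iff_ne_zero.2 hY.det_pos.ne'
  have key := sqrt_smul_abs hZ hZdet
  have hD : √((Y * X * Y).trace.re ^ 2 - 4 * (Y * X * Y).det.re) = absRelDenom Y X := by
    rw [det_conj hY.1 hX, trace_conj, absRelDenom]
  rw [hD] at key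
  -- Conjugation by `Y⁻¹` takes `YXY` back to `X`, and `det(YXY) Y⁻² = det X · Ŷ²` because `Ŷ = det
  -- Y · Y⁻¹`. The adjugate form stays meaningful at singular `Y`.
  have key2 : ((absRelDenom Y X : ℝ) : ℂ) • absRel Y X =
      (((Y * Y * X).trace.re : ℝ) : ℂ) • X
        + ((-2 * X.det.re : ℝ) : ℂ) • (Y.adjugate * Y.adjugate) := by
    have h1 : ((absRelDenom Y X : ℝ) : ℂ) • absRel Y X =
        Y⁻¹ * (((absRelDenom Y X : ℝ) : ℂ) • CFC.abs (Y * X * Y)) * Y⁻¹ := by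
      simp [absRel]
    have hinv : Y⁻¹ * (Y * X * Y) * Y⁻¹ = X := by
      rw [Matrix.mul_assoc Y X Y, Matrix.nonsing_inv_mul_cancel_left _ _ hYu,
        Matrix.mul_nonsing_inv_cancel_right _ _ hYu]
    have hadj : Y.adjugate = Y.det • Y⁻¹ := by
      rw [Matrix.inv_def, smul_smul, Ring.mul_inverse_cancel _ hYu, one_smul]
    rw [h1, key, Matrix.mul_sub, Matrix.sub_mul, Matrix.mul_smul, Matrix.smul_mul, hinv,
      Matrix.mul_smul, Matrix.smul_mul, Matrix.mul_one, hadj, Matrix.smul_mul, Matrix.mul_smul,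
      ← trace_conj, IsHermitian.trace_ofReal hZ, Matrix.det_mul, Matrix.det_mul, smul_smul,
      smul_smul, sub_eq_add_neg, ← neg_smul]
    push_cast
    rw [IsHermitian.det_ofReal hX]
    congr 2
    ring
  calc absRel Y X = ((absRelDenom Y X : ℝ) : ℂ)⁻¹ • (((absRelDenom Y X : ℝ) : ℂ) • absRel Y X) := by
        rw [smul_smul, inv_mul_cancel₀ hsC, one_smul]
    _ = _ := by
        rw [key2, smul_add, smul_smul, smul_smul]
        push_cast
        congr 2 <;> ring

lemma absRel_posDef {Y X : Op} (hY : Y.PosDef) (hX : X.IsHermitian) (hdet : X.det.re < 0) :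
    (absRel Y X).PosDef := by
  have hYu : IsUnit Y.det := isUnit_iff_ne_zero.2 hY.det_pos.ne'
  have hZ := isHermitian_conj hY.1 hX
  have hZdet : (Y * X * Y).det ≠ 0 := by
    intro h
    have h' : (Y * X * Y).det.re < 0 := by
      rw [det_conj hY.1 hX]; exact mul_neg_of_pos_of_neg (by have := det_re_pos hY; positivity) hdet
    simp [h] at h'
  have hA : (CFC.abs (Y * X * Y)).PosDef := by
    have hA : (CFC.abs (Y * X * Y)).PosSemidef :=
      Matrix.nonneg_iff_posSemidef.1 (CFC.abs_nonneg _)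
    refine hA.posDef_iff_isUnit.2 ?_
    rw [Matrix.isUnit_iff_isUnit_det, isUnit_iff_ne_zero]
    intro h
    have hAA : CFC.abs (Y * X * Y) * CFC.abs (Y * X * Y) = (Y * X * Y) * (Y * X * Y) := by
      rw [CFC.abs_mul_abs, Matrix.star_eq_conjTranspose, hZ.eq]
    have := congrArg Matrix.det hAA
    rw [Matrix.det_mul, Matrix.det_mul, h, zero_mul] at this
    exact mul_ne_zero hZdet hZdet this.symm
  have hYi : (Y⁻¹).IsHermitian := hY.1.inv
  have := hA.mul_mul_conjTranspose_same (B := Y⁻¹)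
    (Matrix.vecMul_injective_of_isUnit ((Matrix.isUnit_nonsing_inv_iff).2
      ((Matrix.isUnit_iff_isUnit_det Y).2 hYu)))
  rwa [hYi.eq] at this

/-! ### Rank-one projectors -/

lemma RP1.det_eq_zero {P : Op} (hP : P ∈ RP1) : P.det = 0 := by
  by_contra h
  have := Matrix.rank_of_isUnit P ((Matrix.isUnit_iff_isUnit_det P).2 (isUnit_iff_ne_zero.2 h))
  simp [hP.2.1] at this

lemma RP1.trace_eq_one {P : Op} (hP : P ∈ RP1) : P.trace = 1 := by
  have hdet := RP1.det_eq_zero hP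
  obtain ⟨hproj, hrank, -⟩ := hP
  have hne : P ≠ 0 := by
    rintro rfl
    simp at hrank
  have h := mul_self_fin_two P
  rw [hproj.isIdempotentElem.eq, hdet, zero_smul, sub_zero] at h
  have h2 : (P.trace - 1) • P = 0 := by rw [sub_smul, one_smul, ← h, sub_self]
  rcases smul_eq_zero.1 h2 with h3 | h3
  · exact sub_eq_zero.1 h3
  · exact absurd h3 hne

lemma RP1.adjugate_eq {P : Op} (hP : P ∈ RP1) : P.adjugate = 1 - P := by
  rw [adjugate_eq_trace_sub, RP1.trace_eq_one hP, one_smul]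

lemma RP1.adjugate_mul_self {P : Op} (hP : P ∈ RP1) : P.adjugate * P.adjugate = P.adjugate := by
  rw [RP1.adjugate_eq hP]
  exact hP.1.isIdempotentElem.one_sub.eq

lemma RP1.trace_adjugate {P : Op} (hP : P ∈ RP1) : P.adjugate.trace = 1 := by
  rw [RP1.adjugate_eq hP, Matrix.trace_sub, RP1.trace_eq_one hP]
  simp
  norm_num

/-! ### The tangent to the steering ellipse is indefinite -/

/-- A real symmetric matrix orthogonal to a definite one is indefinite. -/
lemma indefinite_of_orthogonal {p q s a b d : ℝ} (h : q ^ 2 < p * s)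
    (ho : p * a + 2 * q * b + s * d = 0) (hne : ¬(a = 0 ∧ b = 0 ∧ d = 0)) : a * d - b * b < 0 := by
  have hp : p ≠ 0 := by
    rintro rfl
    nlinarith [sq_nonneg q]
  have hp2 : 0 < p ^ 2 := by positivity
  by_contra hcon
  push Not at hcon
  -- Eliminate `a` with the orthogonality relation and complete the square in `b`.
  have e : p ^ 2 * (a * d - b * b) = -((p * b + q * d) ^ 2 + (p * s - q ^ 2) * d ^ 2) := by
    linear_combination p * d * ho
  have h0 : 0 ≤ p ^ 2 * (a * d - b * b) := mul_nonneg hp2.le hcon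
  have hps : 0 < p * s - q ^ 2 := by linarith
  have h1 : 0 ≤ (p * s - q ^ 2) * d ^ 2 := by positivity
  have h2 : (p * s - q ^ 2) * d ^ 2 = 0 := by nlinarith [sq_nonneg (p * b + q * d)]
  have hd : d = 0 := by
    rcases mul_eq_zero.1 h2 with h3 | h3
    · exact absurd h3 hps.ne'
    · simpa using h3
  subst hd
  have h3 : (p * b) ^ 2 = 0 := by nlinarith [sq_nonneg (p * b)]
  have hb : b = 0 := by
    have := pow_eq_zero_iff (two_ne_zero) |>.1 h3
    exact (mul_eq_zero.1 this).resolve_left hp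
  subst hb
  have ha : a = 0 := by
    have : p * a = 0 := by linarith
    exact (mul_eq_zero.1 this).resolve_left hp
  exact hne ⟨ha, rfl, rfl⟩

/-- Coefficient of `cos θ` in the steered state `ρ̃_B(θ)`. -/
noncomputable def cosCoeff (ρ : Op₂) : Op :=
  Matrix.of fun i j => (ρ (0, i) (0, j) - ρ (1, i) (1, j)) / 2

/-- Coefficient of `sin θ` in the steered state `ρ̃_B(θ)`. -/
noncomputable def sinCoeff (ρ : Op₂) : Op :=
  Matrix.of fun i j => (ρ (0, i) (1, j) + ρ (1, i) (0, j)) / 2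

lemma steered_apply (ρ : Op₂) (θ : ℝ) (i j : Fin 2) :
    steered ρ θ i j = (ρ (0, i) (0, j) + ρ (1, i) (1, j)) / 2
      + (Real.cos θ : ℂ) * cosCoeff ρ i j + (Real.sin θ : ℂ) * sinCoeff ρ i j := by
  have hc : (Real.cos θ : ℂ) = 2 * (Real.cos (θ / 2) : ℂ) ^ 2 - 1 := by
    rw [← mul_div_cancel₀ θ (two_ne_zero), mul_div_assoc, Real.cos_two_mul]; push_cast; ring_nf
  have hs : (Real.sin θ : ℂ) = 2 * (Real.sin (θ / 2) : ℂ) * (Real.cos (θ / 2) : ℂ) := by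
    rw [← mul_div_cancel₀ θ (two_ne_zero), mul_div_assoc, Real.sin_two_mul]; push_cast; ring_nf
  have h1 : (Real.sin (θ / 2) : ℂ) ^ 2 = 1 - (Real.cos (θ / 2) : ℂ) ^ 2 := by
    have := Real.sin_sq (θ / 2)
    exact_mod_cast this
  rw [hc, hs]
  have key : steered ρ θ i j = (Real.cos (θ / 2) : ℂ) ^ 2 * ρ (0, i) (0, j)
      + (Real.cos (θ / 2) : ℂ) * (Real.sin (θ / 2) : ℂ) * (ρ (0, i) (1, j) + ρ (1, i) (0, j))
      + (Real.sin (θ / 2) : ℂ) ^ 2 * ρ (1, i) (1, j) := by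
    have hp : ∀ a b, proj θ a b = ket θ a * star (ket θ b) := fun a b => rfl
    have h0 : ket θ 0 = (Real.cos (θ / 2) : ℂ) := rfl
    have h1 : ket θ 1 = (Real.sin (θ / 2) : ℂ) := rfl
    fin_cases i <;> fin_cases j <;>
      simp [steered, traceA, Matrix.mul_apply, Fintype.sum_prod_type, hp, h0, h1,
        -Complex.ofReal_cos, -Complex.ofReal_sin] <;> ring
  rw [key, h1]
  simp only [cosCoeff, sinCoeff, Matrix.of_apply]
  ring

lemma steeredDeriv_eq (ρ : Op₂) (θ : ℝ) :
    steeredDeriv ρ θ = (-Real.sin θ) • cosCoeff ρ + Real.cos θ • sinCoeff ρ := by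
  ext i j
  have h : HasDerivAt (fun t : ℝ => steered ρ t i j)
      (((-Real.sin θ : ℝ) : ℂ) * cosCoeff ρ i j + (Real.cos θ : ℂ) * sinCoeff ρ i j) θ := by
    simp only [steered_apply]
    have h1 := ((Real.hasDerivAt_cos θ).ofReal_comp).mul_const (cosCoeff ρ i j)
    have h2 := ((Real.hasDerivAt_sin θ).ofReal_comp).mul_const (sinCoeff ρ i j)
    exact (h1.const_add _).add h2
  simp only [steeredDeriv, Matrix.of_apply, h.deriv, Matrix.add_apply, Matrix.smul_apply,
    Complex.real_smul]

lemma steered_sub (ρ : Op₂) (θ θ' : ℝ) :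
    steered ρ θ - steered ρ θ' = (Real.cos θ - Real.cos θ') • cosCoeff ρ
      + (Real.sin θ - Real.sin θ') • sinCoeff ρ := by
  ext i j
  simp only [Matrix.sub_apply, steered_apply, Matrix.add_apply, Matrix.smul_apply,
    Complex.real_smul, Complex.ofReal_sub]
  ring

/-- The tangent at `θ` is half the chord joining the points at `θ ± π/2`, so no limit of secants is
needed. -/
lemma steeredDeriv_mem_direction (ρ : Op₂) (θ : ℝ) :
    steeredDeriv ρ θ ∈ (affineSpan ℝ (ellipse ρ)).direction := by
  have h : steeredDeriv ρ θ
      = (1 / 2 : ℝ) • (steered ρ (θ + Real.pi / 2) - steered ρ (θ - Real.pi / 2)) := by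
    rw [steered_sub, steeredDeriv_eq, Real.cos_add_pi_div_two, Real.cos_sub_pi_div_two,
      Real.sin_add_pi_div_two, Real.sin_sub_pi_div_two, smul_add, smul_smul, smul_smul]
    congr 2 <;> ring
  rw [h]
  exact Submodule.smul_mem _ _ (AffineSubspace.vsub_mem_direction
    (subset_affineSpan ℝ _ ⟨_, rfl⟩) (subset_affineSpan ℝ _ ⟨_, rfl⟩))

/-- A vanishing tangent makes the two coefficients proportional to a single operator `V`, and the
ellipse would then lie on a line. -/
lemma steeredDeriv_ne_zero {ρ : Op₂}
    (h : Module.finrank ℝ (affineSpan ℝ (ellipse ρ)).direction = 2) (θ : ℝ) :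
    steeredDeriv ρ θ ≠ 0 := by
  intro h0
  rw [steeredDeriv_eq] at h0
  set V : Op := Real.cos θ • cosCoeff ρ + Real.sin θ • sinCoeff ρ with hV
  have hsc := Real.sin_sq_add_cos_sq θ
  have hA : cosCoeff ρ = Real.cos θ • V := by
    have : Real.cos θ • V = (Real.sin θ ^ 2 + Real.cos θ ^ 2) • cosCoeff ρ
        + Real.sin θ • ((-Real.sin θ) • cosCoeff ρ + Real.cos θ • sinCoeff ρ) := by
      rw [hV]; module
    rw [this, h0, hsc, one_smul, smul_zero, add_zero]
  have hB : sinCoeff ρ = Real.sin θ • V := by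
    have : Real.sin θ • V = (Real.sin θ ^ 2 + Real.cos θ ^ 2) • sinCoeff ρ
        - Real.cos θ • ((-Real.sin θ) • cosCoeff ρ + Real.cos θ • sinCoeff ρ) := by
      rw [hV]; module
    rw [this, h0, hsc, one_smul, smul_zero, sub_zero]
  have hle : (affineSpan ℝ (ellipse ρ)).direction ≤ Submodule.span ℝ {V} := by
    rw [direction_affineSpan, vectorSpan_def, Submodule.span_le]
    rintro _ ⟨_, ⟨s, rfl⟩, _, ⟨t, rfl⟩, rfl⟩
    simp only [vsub_eq_sub, steered_sub]
    rw [hA, hB, smul_smul, smul_smul, ← add_smul]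
    exact Submodule.smul_mem _ _ (Submodule.mem_span_singleton_self V)
  have h1 := Submodule.finrank_mono hle
  have h2 := finrank_span_le_card (R := ℝ) ({V} : Set Op)
  simp at h2
  omega

lemma isHermitian_of_real {X : Op} (h00 : (X 0 0).im = 0) (h01 : (X 0 1).im = 0)
    (h11 : (X 1 1).im = 0) (hs : X 1 0 = X 0 1) : X.IsHermitian := by
  ext i j
  fin_cases i <;> fin_cases j <;> simp [Complex.ext_iff, hs, h00, h01, h11]

lemma real_symm {ρ : Op₂} (hρ : ρ ∈ realDensity (Fin 2 × Fin 2)) (x y : Fin 2 × Fin 2) :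
    ρ x y = ρ y x := by
  have h := hρ.1.1.1.apply x y
  rw [← h, Complex.star_def]
  exact Complex.conj_eq_iff_im.2 (hρ.2 y x)

lemma cosCoeff_real {ρ : Op₂} (hρ : ρ ∈ realDensity (Fin 2 × Fin 2)) (i j : Fin 2) :
    (cosCoeff ρ i j).im = 0 := by
  simp [cosCoeff, hρ.2 _ _]

lemma sinCoeff_real {ρ : Op₂} (hρ : ρ ∈ realDensity (Fin 2 × Fin 2)) (i j : Fin 2) :
    (sinCoeff ρ i j).im = 0 := by
  simp [sinCoeff, hρ.2 _ _]

lemma steeredDeriv_real {ρ : Op₂} (hρ : ρ ∈ realDensity (Fin 2 × Fin 2)) (θ : ℝ) (i j : Fin 2) :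
    (steeredDeriv ρ θ i j).im = 0 := by
  rw [steeredDeriv_eq]
  simp [cosCoeff_real hρ, sinCoeff_real hρ]

lemma steeredDeriv_symm {ρ : Op₂} (hρ : ρ ∈ realDensity (Fin 2 × Fin 2)) (θ : ℝ) :
    steeredDeriv ρ θ 1 0 = steeredDeriv ρ θ 0 1 := by
  rw [steeredDeriv_eq]
  simp only [cosCoeff, sinCoeff, Matrix.add_apply, Matrix.smul_apply, Matrix.of_apply]
  rw [real_symm hρ (0, 1) (0, 0), real_symm hρ (1, 1) (1, 0), real_symm hρ (0, 1) (1, 0),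
    real_symm hρ (1, 1) (0, 0), add_comm (ρ (1, 0) (0, 1))]

lemma steeredDeriv_isHermitian {ρ : Op₂} (hρ : ρ ∈ realDensity (Fin 2 × Fin 2)) (θ : ℝ) :
    (steeredDeriv ρ θ).IsHermitian :=
  isHermitian_of_real (steeredDeriv_real hρ θ _ _) (steeredDeriv_real hρ θ _ _)
    (steeredDeriv_real hρ θ _ _) (steeredDeriv_symm hρ θ)

lemma steeringTilt_lt_one {ρ : Op₂} (h : steeringTilt ρ < 1) :
    Module.finrank ℝ (affineSpan ℝ (ellipse ρ)).direction = 2 ∧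
      ∃ N ∈ normals (ellipse ρ), tilt N < 1 := by
  unfold steeringTilt at h
  split_ifs at h with hf
  · refine ⟨hf, ?_⟩
    obtain ⟨N, hN⟩ := iInf_lt_iff.1 h
    obtain ⟨hN1, hN2⟩ := iInf_lt_iff.1 hN
    exact ⟨N, hN1, hN2⟩
  · simp at h

/-- An operator of tilt less than one is definite. -/
lemma definite_of_tilt_lt_one {N : Op} (hN : tilt N < 1) (hsymm : N 1 0 = N 0 1) :
    (N 0 1).re ^ 2 < (N 0 0).re * (N 1 1).re := by
  unfold tilt at hN
  split_ifs at hN with h0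
  · simp at hN
  · rw [ENNReal.ofReal_lt_one, div_lt_one (abs_pos.2 h0), Real.sqrt_lt' (abs_pos.2 h0),
      sq_abs] at hN
    simp [Matrix.trace_fin_two, σ₁, σ₃, Matrix.mul_apply, Fin.sum_univ_two, hsymm] at hN
    -- The tilt bound reads `(N₀₀ - N₁₁)² + 4 N₀₁² < (N₀₀ + N₁₁)²`.
    nlinarith

lemma steeredDeriv_det_neg {ρ : Op₂} (hρ : ρ ∈ realDensity (Fin 2 × Fin 2))
    (htilt : steeringTilt ρ < 1) (θ : ℝ) : (steeredDeriv ρ θ).det.re < 0 := by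
  obtain ⟨hf, N, ⟨-, hNh, hNr, hNo⟩, hNt⟩ := steeringTilt_lt_one htilt
  have hX := steeredDeriv_real hρ θ
  have hXs := steeredDeriv_symm hρ θ
  have hX0 := steeredDeriv_ne_zero hf θ
  have ho := hNo _ (steeredDeriv_mem_direction ρ θ)
  rw [hNh.eq] at ho
  have hNs : N 1 0 = N 0 1 := by
    rw [← hNh.apply 1 0, Complex.star_def]
    exact Complex.conj_eq_iff_im.2 (hNr 0 1)
  have hdef := definite_of_tilt_lt_one hNt hNs
  generalize steeredDeriv ρ θ = X at *
  have ho' := congrArg Complex.re ho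
  simp only [Matrix.trace_fin_two, Matrix.mul_apply, Fin.sum_univ_two, hNs, hXs, Complex.add_re,
    Complex.mul_re, hNr _ _, hX _ _, mul_zero, sub_zero, Complex.zero_re] at ho'
  simp only [Matrix.det_fin_two, hXs, Complex.sub_re, Complex.mul_re, hX _ _, mul_zero, sub_zero]
  refine indefinite_of_orthogonal hdef (by linear_combination ho') ?_
  rintro ⟨ha, hb, hd⟩
  refine hX0 ?_
  ext i j
  fin_cases i <;> fin_cases j <;> simp [Complex.ext_iff, hX, ha, hb, hd, hXs]

/-! ### A criterion for logarithmic divergence -/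

/-- `∫₀¹ du / (ε + K u) = log ((ε + K) / ε) / K`, with the integral shifted to `[c, c + 1]`. -/
lemma integral_inv_affine {ε K : ℝ} (hε : 0 < ε) (hK : 0 < K) (c : ℝ) :
    ∫ x in c..c + 1, (ε + K * (x - c))⁻¹ = (Real.log (ε + K) - Real.log ε) / K := by
  have hpos : ∀ x ∈ Set.uIcc c (c + 1), 0 < ε + K * (x - c) := by
    intro x hx
    rw [Set.uIcc_of_le (by linarith)] at hx
    have : 0 ≤ K * (x - c) := mul_nonneg hK.le (by linarith [hx.1])
    linarith
  rw [intervalIntegral.integral_eq_sub_of_hasDerivAt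
    (f := fun x => Real.log (ε + K * (x - c)) / K)]
  · simp [sub_div]
  · intro x hx
    have h1 : HasDerivAt (fun x => ε + K * (x - c)) K x := by
      simpa using (((hasDerivAt_id x).sub_const c).const_mul K).const_add ε
    have h2 := (h1.log (hpos x hx).ne').div_const K
    have h3 : (ε + K * (x - c))⁻¹ = K / (ε + K * (x - c)) / K := by
      rw [div_right_comm, div_self hK.ne', one_div]
    rwa [h3]
  · apply ContinuousOn.intervalIntegrable
    apply ContinuousOn.inv₀ (by fun_prop)
    intro x hx
    exact (hpos x hx).ne'

/-- Integrals of functions that are bounded below by `m / (ε + K (x - c))` on `[c, c + 1]` diverge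
as `ε → 0`. -/
lemma tendsto_integral_atTop {α : Type*} {l : Filter α} {f : α → ℝ → ℝ} {ε : α → ℝ}
    {K m a b c : ℝ} (hK : 0 < K) (hm : 0 < m) (hac : a ≤ c) (hcb : c + 1 ≤ b)
    (hε : Tendsto ε l (𝓝 0)) (hε0 : ∀ᶠ y in l, 0 < ε y)
    (hfc : ∀ᶠ y in l, Continuous (f y)) (hf0 : ∀ᶠ y in l, ∀ x, 0 ≤ f y x)
    (hf : ∀ᶠ y in l, ∀ x ∈ Set.Icc c (c + 1), m / (ε y + K * (x - c)) ≤ f y x) :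
    Tendsto (fun y => ∫ x in a..b, f y x) l atTop := by
  have hlog : Tendsto (fun y => m * ((Real.log K - Real.log (ε y)) / K)) l atTop := by
    refine Tendsto.const_mul_atTop hm (Tendsto.atTop_div_const hK ?_)
    have h1 : Tendsto (fun y => Real.log (ε y)) l atBot :=
      Real.tendsto_log_nhdsGT_zero.comp (tendsto_nhdsWithin_iff.2 ⟨hε, hε0⟩)
    simpa [sub_eq_add_neg] using tendsto_atTop_add_const_left l (Real.log K)
      (tendsto_neg_atBot_atTop.comp h1)
  refine tendsto_atTop_mono' l ?_ hlog
  filter_upwards [hε0, hfc, hf0, hf] with y hy hc h0 hfy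
  calc m * ((Real.log K - Real.log (ε y)) / K)
      ≤ m * ((Real.log (ε y + K) - Real.log (ε y)) / K) := by
        have := Real.log_le_log hK (by linarith : K ≤ ε y + K)
        gcongr
    _ = ∫ x in c..c + 1, m * (ε y + K * (x - c))⁻¹ := by
        rw [intervalIntegral.integral_const_mul, integral_inv_affine hy hK]
    _ ≤ ∫ x in c..c + 1, f y x := by
        refine intervalIntegral.integral_mono_on (by linarith) ?_ (hc.intervalIntegrable _ _) ?_
        · apply ContinuousOn.intervalIntegrable
          refine continuousOn_const.mul (ContinuousOn.inv₀ (by fun_prop) ?_)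
          intro x hx
          rw [Set.uIcc_of_le (by linarith)] at hx
          have : 0 ≤ K * (x - c) := mul_nonneg hK.le (by linarith [hx.1])
          linarith
        · intro x hx
          simpa [div_eq_mul_inv] using hfy x hx
    _ ≤ ∫ x in a..b, f y x :=
        intervalIntegral.integral_mono_interval hac (by linarith) hcb
          (Eventually.of_forall fun x => h0 x) (hc.intervalIntegrable _ _)

/-! ### The integrand along the ellipse -/

lemma continuous_steeredDeriv (ρ : Op₂) : Continuous (steeredDeriv ρ) := by
  have h : steeredDeriv ρ = fun θ => (-Real.sin θ) • cosCoeff ρ + Real.cos θ • sinCoeff ρ :=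
    funext (steeredDeriv_eq ρ)
  rw [h]
  fun_prop

lemma continuous_steeredDeriv_det (ρ : Op₂) : Continuous fun θ => (steeredDeriv ρ θ).det.re :=
  Complex.continuous_re.comp (continuous_steeredDeriv ρ).matrix_det

lemma continuous_trace_steeredDeriv (ρ : Op₂) (Y : Op) :
    Continuous fun θ => (Y * Y * steeredDeriv ρ θ).trace.re :=
  Complex.continuous_re.comp
    (Continuous.matrix_trace (continuous_const.matrix_mul (continuous_steeredDeriv ρ)))

lemma continuous_absRelDenom (ρ : Op₂) (Y : Op) :
    Continuous fun θ => absRelDenom Y (steeredDeriv ρ θ) := by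
  unfold absRelDenom
  have h1 := continuous_steeredDeriv_det ρ
  have h2 := continuous_trace_steeredDeriv ρ Y
  fun_prop

/-- The coefficient of `X` in `|X|_Y`, for `X = dρ̃_B/dθ`. -/
noncomputable def boundedCoeff (ρ : Op₂) (Y : Op) (θ : ℝ) : ℝ :=
  (Y * Y * steeredDeriv ρ θ).trace.re / absRelDenom Y (steeredDeriv ρ θ)

/-- The coefficient of `Ŷ²` in `|X|_Y`, for `X = dρ̃_B/dθ`. -/
noncomputable def divergentCoeff (ρ : Op₂) (Y : Op) (θ : ℝ) : ℝ :=
  -2 * (steeredDeriv ρ θ).det.re / absRelDenom Y (steeredDeriv ρ θ)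

section

variable {ρ : Op₂} (hρ : ρ ∈ realDensity (Fin 2 × Fin 2)) (htilt : steeringTilt ρ < 1)
variable {Y : Op} (hY : Y.PosDef)
include hρ htilt hY

lemma continuous_boundedCoeff : Continuous (boundedCoeff ρ Y) :=
  (continuous_trace_steeredDeriv ρ Y).div (continuous_absRelDenom ρ Y) fun θ =>
    (absRelDenom_pos hY (steeredDeriv_det_neg hρ htilt θ)).ne'

lemma continuous_divergentCoeff : Continuous (divergentCoeff ρ Y) :=
  (continuous_const.mul (continuous_steeredDeriv_det ρ)).div (continuous_absRelDenom ρ Y)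
    fun θ => (absRelDenom_pos hY (steeredDeriv_det_neg hρ htilt θ)).ne'

/-- Since `det X < 0`, the radicand in the denominator is at least the square of the numerator. The
bound is uniform in `Y`. -/
lemma abs_boundedCoeff_le (θ : ℝ) : |boundedCoeff ρ Y θ| ≤ 1 := by
  have hdet := steeredDeriv_det_neg hρ htilt θ
  have hs := absRelDenom_pos hY hdet
  rw [boundedCoeff, abs_div, abs_of_pos hs, div_le_one hs]
  refine Real.abs_le_sqrt ?_
  nlinarith [mul_nonneg (sq_nonneg Y.det.re) (neg_nonneg.2 hdet.le)]

lemma divergentCoeff_nonneg (θ : ℝ) : 0 ≤ divergentCoeff ρ Y θ := by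
  have hdet := steeredDeriv_det_neg hρ htilt θ
  exact div_nonneg (by linarith) (absRelDenom_pos hY hdet).le

lemma absRel_steeredDeriv (θ : ℝ) :
    absRel Y (steeredDeriv ρ θ) = (boundedCoeff ρ Y θ : ℂ) • steeredDeriv ρ θ
      + (divergentCoeff ρ Y θ : ℂ) • (Y.adjugate * Y.adjugate) :=
  absRel_eq hY (steeredDeriv_isHermitian hρ θ) (steeredDeriv_det_neg hρ htilt θ)

lemma continuous_absRel_steeredDeriv (i j : Fin 2) :
    Continuous fun θ => absRel Y (steeredDeriv ρ θ) i j := by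
  have h1 := continuous_boundedCoeff hρ htilt hY
  have h2 := continuous_divergentCoeff hρ htilt hY
  have h3 := (continuous_steeredDeriv ρ).matrix_elem i j
  simp only [absRel_steeredDeriv hρ htilt hY, Matrix.add_apply, Matrix.smul_apply, smul_eq_mul]
  fun_prop

/-- The integrand is positive definite at every angle, so its trace integrates to a positive number.
-/
lemma steeringOperator_trace_ne_zero : (steeringOperator ρ Y).trace ≠ 0 := by
  have hc := continuous_absRel_steeredDeriv hρ htilt hY
  have h : (steeringOperator ρ Y).trace
      = ∫ θ in (0 : ℝ)..(2 * Real.pi), (absRel Y (steeredDeriv ρ θ)).trace := by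
    simp only [Matrix.trace_fin_two, steeringOperator, Matrix.of_apply]
    rw [intervalIntegral.integral_add ((hc 0 0).intervalIntegrable _ _)
      ((hc 1 1).intervalIntegrable _ _)]
  have hpd θ := absRel_posDef hY (steeredDeriv_isHermitian hρ θ) (steeredDeriv_det_neg hρ htilt θ)
  have hre θ : (absRel Y (steeredDeriv ρ θ)).trace
      = (((absRel Y (steeredDeriv ρ θ)).trace.re : ℝ) : ℂ) :=
    (IsHermitian.trace_ofReal (hpd θ).1).symm
  rw [h, intervalIntegral.integral_congr fun θ _ => hre θ, intervalIntegral.integral_ofReal]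
  have hpos : 0 < ∫ θ in (0 : ℝ)..(2 * Real.pi), (absRel Y (steeredDeriv ρ θ)).trace.re := by
    refine intervalIntegral.intervalIntegral_pos_of_pos_on ?_ ?_ Real.two_pi_pos
    · apply Continuous.intervalIntegrable
      simp only [Matrix.trace_fin_two]
      exact Complex.continuous_re.comp ((hc 0 0).add (hc 1 1))
    · exact fun θ _ => (Complex.pos_iff.1 (hpd θ).trace_pos).1
  exact_mod_cast hpos.ne'

lemma steeringOperator_apply (i j : Fin 2) :
    steeringOperator ρ Y i j
      = (∫ θ in (0 : ℝ)..(2 * Real.pi), (boundedCoeff ρ Y θ : ℂ) * steeredDeriv ρ θ i j)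
      + ((∫ θ in (0 : ℝ)..(2 * Real.pi), divergentCoeff ρ Y θ : ℝ) : ℂ)
        * (Y.adjugate * Y.adjugate) i j := by
  have h1 := continuous_boundedCoeff hρ htilt hY
  have h2 := continuous_divergentCoeff hρ htilt hY
  have h3 := (continuous_steeredDeriv ρ).matrix_elem i j
  simp only [steeringOperator, Matrix.of_apply, absRel_steeredDeriv hρ htilt hY, Matrix.add_apply,
    Matrix.smul_apply, smul_eq_mul]
  rw [intervalIntegral.integral_add, intervalIntegral.integral_mul_const,
    intervalIntegral.integral_ofReal]
  · exact Continuous.intervalIntegrable (by fun_prop) _ _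
  · exact Continuous.intervalIntegrable (by fun_prop) _ _

end

/-! ### Bounded and divergent parts of the integral -/

lemma norm_steeredDeriv_apply_le (ρ : Op₂) (θ : ℝ) (i j : Fin 2) :
    ‖steeredDeriv ρ θ i j‖ ≤ ‖cosCoeff ρ i j‖ + ‖sinCoeff ρ i j‖ := by
  rw [steeredDeriv_eq, Matrix.add_apply, Matrix.smul_apply, Matrix.smul_apply]
  refine (norm_add_le _ _).trans (add_le_add ?_ ?_) <;> rw [norm_smul, Real.norm_eq_abs]
  · rw [abs_neg]
    exact mul_le_of_le_one_left (norm_nonneg _) (Real.abs_sin_le_one θ)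
  · exact mul_le_of_le_one_left (norm_nonneg _) (Real.abs_cos_le_one θ)

lemma norm_integral_boundedCoeff_le {ρ : Op₂} (hρ : ρ ∈ realDensity (Fin 2 × Fin 2))
    (htilt : steeringTilt ρ < 1) {Y : Op} (hY : Y.PosDef) (i j : Fin 2) :
    ‖∫ θ in (0 : ℝ)..(2 * Real.pi), (boundedCoeff ρ Y θ : ℂ) * steeredDeriv ρ θ i j‖
      ≤ (‖cosCoeff ρ i j‖ + ‖sinCoeff ρ i j‖) * |2 * Real.pi - 0| := by
  refine intervalIntegral.norm_integral_le_of_norm_le_const fun θ _ => ?_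
  rw [norm_mul, Complex.norm_real]
  exact (mul_le_of_le_one_left (norm_nonneg _) (abs_boundedCoeff_le hρ htilt hY θ)).trans
    (norm_steeredDeriv_apply_le ρ θ i j)

lemma trace_mul_steeredDeriv (ρ : Op₂) (Y : Op) (θ : ℝ) :
    (Y * Y * steeredDeriv ρ θ).trace.re = -Real.sin θ * (Y * Y * cosCoeff ρ).trace.re
      + Real.cos θ * (Y * Y * sinCoeff ρ).trace.re := by
  rw [steeredDeriv_eq, Matrix.mul_add, Matrix.mul_smul, Matrix.mul_smul, Matrix.trace_add,
    Matrix.trace_smul, Matrix.trace_smul, Complex.add_re, Complex.smul_re, Complex.smul_re,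
    smul_eq_mul, smul_eq_mul]

/-- The values at `0` and `π` are opposite, so the intermediate value theorem applies. -/
lemma exists_zero_sinusoid (α β : ℝ) :
    ∃ c ∈ Set.Icc 0 Real.pi, -Real.sin c * α + Real.cos c * β = 0 := by
  have hc : ContinuousOn (fun c => -Real.sin c * α + Real.cos c * β) (Set.uIcc 0 Real.pi) := by
    fun_prop
  have h0 : (0 : ℝ) ∈ Set.uIcc (-Real.sin 0 * α + Real.cos 0 * β)
      (-Real.sin Real.pi * α + Real.cos Real.pi * β) := by
    simp only [Real.sin_zero, Real.cos_zero, Real.sin_pi, Real.cos_pi, Set.mem_uIcc]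
    rcases le_total 0 β with h | h
    · right; constructor <;> linarith
    · left; constructor <;> linarith
  obtain ⟨c, hc, h⟩ := intermediate_value_uIcc hc h0
  rw [Set.uIcc_of_le Real.pi_pos.le] at hc
  exact ⟨c, hc, h⟩

/-- Here `α₀, β₀` belong to the limit `P` and `α, β` to a nearby `Y`: the error splits into the
change of coefficients and the Lipschitz growth away from the zero `c`. -/
lemma abs_sinusoid_le {α β α₀ β₀ c : ℝ} (hc : -Real.sin c * α₀ + Real.cos c * β₀ = 0) (θ : ℝ) :
    |-Real.sin θ * α + Real.cos θ * β| ≤ |α - α₀| + |β - β₀| + (|α₀| + |β₀|) * |θ - c| := by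
  have e : -Real.sin θ * α + Real.cos θ * β
      = -Real.sin θ * (α - α₀) + Real.cos θ * (β - β₀)
        + (-((Real.sin θ - Real.sin c) * α₀) + (Real.cos θ - Real.cos c) * β₀) := by
    linear_combination hc
  have h1 : |-Real.sin θ * (α - α₀)| ≤ |α - α₀| := by
    rw [abs_mul, abs_neg]
    exact mul_le_of_le_one_left (abs_nonneg _) (Real.abs_sin_le_one θ)
  have h2 : |Real.cos θ * (β - β₀)| ≤ |β - β₀| := by
    rw [abs_mul]
    exact mul_le_of_le_one_left (abs_nonneg _) (Real.abs_cos_le_one θ)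
  have h3 : |-((Real.sin θ - Real.sin c) * α₀)| ≤ |θ - c| * |α₀| := by
    rw [abs_neg, abs_mul]
    exact mul_le_mul_of_nonneg_right (Real.abs_sin_sub_sin_le θ c) (abs_nonneg _)
  have h4 : |(Real.cos θ - Real.cos c) * β₀| ≤ |θ - c| * |β₀| := by
    rw [abs_mul]
    exact mul_le_mul_of_nonneg_right (Real.abs_cos_sub_cos_le θ c) (abs_nonneg _)
  rw [e]
  refine (abs_add_le _ _).trans ?_
  refine (add_le_add (abs_add_le _ _) (abs_add_le _ _)).trans ?_
  linarith

lemma exists_bounds_det {ρ : Op₂} (hρ : ρ ∈ realDensity (Fin 2 × Fin 2))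
    (htilt : steeringTilt ρ < 1) (a b : ℝ) : ∃ m M : ℝ, 0 < m ∧ 0 < M ∧
      ∀ θ ∈ Set.Icc a b, m ≤ -(steeredDeriv ρ θ).det.re ∧ -(steeredDeriv ρ θ).det.re ≤ M ^ 2 := by
  have hc : ContinuousOn (fun θ => -(steeredDeriv ρ θ).det.re) (Set.Icc a b) :=
    (continuous_steeredDeriv_det ρ).neg.continuousOn
  obtain ⟨m, hm, hm'⟩ := isCompact_Icc.exists_forall_le' hc (a := 0)
    fun θ _ => neg_pos.2 (steeredDeriv_det_neg hρ htilt θ)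
  obtain ⟨M, hM⟩ := isCompact_Icc.bddAbove_image hc
  -- The upper bound is stated as a square so that it leaves the square root in `D`; `M ≤ (|M| +
  -- 1)²`.
  refine ⟨m, |M| + 1, hm, by positivity, fun θ hθ => ⟨hm' θ hθ, ?_⟩⟩
  have h1 : -(steeredDeriv ρ θ).det.re ≤ M := hM ⟨θ, hθ, rfl⟩
  nlinarith [le_abs_self M, abs_nonneg M]

lemma tendsto_integral_divergentCoeff {ρ : Op₂} (hρ : ρ ∈ realDensity (Fin 2 × Fin 2))
    (htilt : steeringTilt ρ < 1) {P : Op} (hP : P.det = 0) :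
    Tendsto (fun Y => ∫ θ in (0 : ℝ)..(2 * Real.pi), divergentCoeff ρ Y θ)
      (𝓝[posDefDensity (Fin 2)] P) atTop := by
  have hcont (A : Op) : Continuous fun Y : Op => (Y * Y * A).trace.re :=
    Complex.continuous_re.comp (Continuous.matrix_trace
      ((continuous_id.matrix_mul continuous_id).matrix_mul continuous_const))
  have hdetc : Continuous fun Y : Op => Y.det.re :=
    Complex.continuous_re.comp continuous_id.matrix_det
  obtain ⟨α, hα⟩ : ∃ α : Op → ℝ, α = fun Y => (Y * Y * cosCoeff ρ).trace.re := ⟨_, rfl⟩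
  obtain ⟨β, hβ⟩ : ∃ β : Op → ℝ, β = fun Y => (Y * Y * sinCoeff ρ).trace.re := ⟨_, rfl⟩
  have hαc : Continuous α := hα ▸ hcont (cosCoeff ρ)
  have hβc : Continuous β := hβ ▸ hcont (sinCoeff ρ)
  obtain ⟨c, hc, hc0⟩ := exists_zero_sinusoid (α P) (β P)
  obtain ⟨m, M, hm, hM, hmM⟩ := exists_bounds_det hρ htilt c (c + 1)
  have hmem : ∀ᶠ Y in 𝓝[posDefDensity (Fin 2)] P, Y.PosDef := by
    filter_upwards [self_mem_nhdsWithin] with Y hY using hY.1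
  have hε : Tendsto (fun Y => |α Y - α P| + |β Y - β P| + 2 * Y.det.re * M)
      (𝓝[posDefDensity (Fin 2)] P) (𝓝 0) := by
    have h : Continuous fun Y => |α Y - α P| + |β Y - β P| + 2 * Y.det.re * M :=
      ((hαc.sub continuous_const).abs.add (hβc.sub continuous_const).abs).add
        ((continuous_const.mul hdetc).mul continuous_const)
    have h' := (h.tendsto P).mono_left (nhdsWithin_le_nhds (s := posDefDensity (Fin 2)))
    simpa [hP] using h'
  -- The `+ 1` keeps `K` positive even if both limiting coefficients vanish. As `c ≤ π` and `π > 3`,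
  -- the interval `[c, c + 1]` fits in `[0, 2π]`.
  refine tendsto_integral_atTop (K := |α P| + |β P| + 1) (m := 2 * m) (c := c) (by positivity)
    (by positivity) hc.1 (by linarith [hc.2, Real.pi_gt_three]) hε ?_ ?_ ?_ ?_
  · filter_upwards [hmem] with Y hY
    have := det_re_pos hY
    positivity
  · filter_upwards [hmem] with Y hY using continuous_divergentCoeff hρ htilt hY
  · filter_upwards [hmem] with Y hY using divergentCoeff_nonneg hρ htilt hY
  · filter_upwards [hmem] with Y hY θ hθ
    have hy := det_re_pos hY
    have hdet := steeredDeriv_det_neg hρ htilt θ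
    obtain ⟨hlo, hhi⟩ := hmM θ hθ
    have hθc : 0 ≤ θ - c := by linarith [hθ.1]
    have ht : |(Y * Y * steeredDeriv ρ θ).trace.re|
        ≤ |α Y - α P| + |β Y - β P| + (|α P| + |β P|) * (θ - c) := by
      rw [trace_mul_steeredDeriv]
      have h := abs_sinusoid_le (α := α Y) (β := β Y) hc0 θ
      rw [abs_of_nonneg hθc] at h
      simpa only [hα, hβ] using h
    -- This is `√(u² + v²) ≤ |u| + |v|`, with the determinant of `X` bounded by `M²`.
    have hden : absRelDenom Y (steeredDeriv ρ θ)
        ≤ |(Y * Y * steeredDeriv ρ θ).trace.re| + 2 * Y.det.re * M := by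
      refine Real.sqrt_le_iff.2 ⟨by positivity, ?_⟩
      have h1 : Y.det.re ^ 2 * -(steeredDeriv ρ θ).det.re ≤ Y.det.re ^ 2 * M ^ 2 := by gcongr
      have h2 : 0 ≤ |(Y * Y * steeredDeriv ρ θ).trace.re| * (2 * Y.det.re * M) := by positivity
      rw [add_sq, sq_abs]
      nlinarith
    refine div_le_div₀ (by linarith) (by linarith) (absRelDenom_pos hY hdet) ?_
    linarith

/-! ### The normalized limit -/

lemma normalized_smul {r : ℂ} (hr : r ≠ 0) (X : Op) : normalized (r • X) = normalized X := by
  rw [normalized, normalized, Matrix.trace_smul, smul_smul, smul_eq_mul, mul_inv, mul_right_comm,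
    inv_mul_cancel₀ hr, one_mul]

lemma tendsto_normalized {α : Type*} {l : Filter α} {f : α → Op} {A : Op}
    (hf : Tendsto f l (𝓝 A)) (hA : A.trace = 1) :
    Tendsto (fun y => normalized (f y)) l (𝓝 A) := by
  have ht : Tendsto (fun y => (f y).trace) l (𝓝 A.trace) :=
    ((continuous_id.matrix_trace).tendsto A).comp hf
  have h := (ht.inv₀ (by simp [hA])).smul hf
  simpa [normalized, hA] using h

lemma tendsto_normalized_steeringOperator {ρ : Op₂} (hρ : ρ ∈ realDensity (Fin 2 × Fin 2))
    (htilt : steeringTilt ρ < 1) {P : Op} (hP : P ∈ RP1) :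
    Tendsto (fun Y => normalized (steeringOperator ρ Y)) (𝓝[posDefDensity (Fin 2)] P)
      (𝓝 P.adjugate) := by
  set J := fun Y => ∫ θ in (0 : ℝ)..(2 * Real.pi), divergentCoeff ρ Y θ
  have hJ : Tendsto J (𝓝[posDefDensity (Fin 2)] P) atTop :=
    tendsto_integral_divergentCoeff hρ htilt (RP1.det_eq_zero hP)
  have hmem : ∀ᶠ Y in 𝓝[posDefDensity (Fin 2)] P, Y.PosDef := by
    filter_upwards [self_mem_nhdsWithin] with Y hY using hY.1
  have hadj : Tendsto (fun Y : Op => Y.adjugate * Y.adjugate) (𝓝[posDefDensity (Fin 2)] P)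
      (𝓝 P.adjugate) := by
    have h : Continuous fun Y : Op => Y.adjugate * Y.adjugate :=
      continuous_id.matrix_adjugate.matrix_mul continuous_id.matrix_adjugate
    have h' := (h.tendsto P).mono_left (nhdsWithin_le_nhds (s := posDefDensity (Fin 2)))
    rwa [RP1.adjugate_mul_self hP] at h'
  -- Normalization ignores scalars, so one may divide by the divergent integral `J`: the bounded
  -- part vanishes and `Ŷ²` gets coefficient one.
  have hS : Tendsto (fun Y => (((J Y)⁻¹ : ℝ) : ℂ) • steeringOperator ρ Y)
      (𝓝[posDefDensity (Fin 2)] P) (𝓝 P.adjugate) := by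
    refine tendsto_pi_nhds.2 fun i => tendsto_pi_nhds.2 fun j => ?_
    have hB : Tendsto (fun Y => (((J Y)⁻¹ : ℝ) : ℂ) *
        ∫ θ in (0 : ℝ)..(2 * Real.pi), (boundedCoeff ρ Y θ : ℂ) * steeredDeriv ρ θ i j)
        (𝓝[posDefDensity (Fin 2)] P) (𝓝 0) := by
      refine squeeze_zero_norm' (a := fun Y => (J Y)⁻¹ *
        ((‖cosCoeff ρ i j‖ + ‖sinCoeff ρ i j‖) * |2 * Real.pi - 0|)) ?_
        (by simpa only [zero_mul, Pi.inv_apply] using hJ.inv_tendsto_atTop.mul_const _)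
      filter_upwards [hmem, hJ.eventually_gt_atTop 0] with Y hY hJY
      rw [norm_mul, Complex.norm_real, Real.norm_of_nonneg (inv_nonneg.2 hJY.le)]
      exact mul_le_mul_of_nonneg_left (norm_integral_boundedCoeff_le hρ htilt hY i j)
        (inv_nonneg.2 hJY.le)
    have hA : Tendsto (fun Y : Op => (Y.adjugate * Y.adjugate) i j)
        (𝓝[posDefDensity (Fin 2)] P) (𝓝 (P.adjugate i j)) :=
      tendsto_pi_nhds.1 (tendsto_pi_nhds.1 hadj i) j
    have hsum := hB.add hA
    rw [zero_add] at hsum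
    refine hsum.congr' ?_
    filter_upwards [hmem, hJ.eventually_gt_atTop 0] with Y hY hJY
    have hJC : (J Y : ℂ) ≠ 0 := by exact_mod_cast hJY.ne'
    rw [Matrix.smul_apply, smul_eq_mul, steeringOperator_apply hρ htilt hY, mul_add,
      ← mul_assoc _ ((∫ θ in (0 : ℝ)..(2 * Real.pi), divergentCoeff ρ Y θ : ℝ) : ℂ),
      Complex.ofReal_inv, inv_mul_cancel₀ hJC, one_mul]
  refine (tendsto_normalized hS (RP1.trace_adjugate hP)).congr' ?_
  filter_upwards [hJ.eventually_gt_atTop 0] with Y hJY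
  exact normalized_smul (by exact_mod_cast (inv_pos.2 hJY).ne') _

end Steering

open Steering in
theorem theorem1 (ρ : Op₂) (hρ : ρ ∈ realDensity (Fin 2 × Fin 2))
    (htilt : steeringTilt ρ < 1) (P : Op) (hP : P ∈ RP1) :
    -- the integral exists and can be normalized, for every `Y`
    (∀ Y ∈ posDefDensity (Fin 2),
      (∀ i j, IntervalIntegrable (fun θ => absRel Y (steeredDeriv ρ θ) i j)
        MeasureTheory.volume 0 (2 * Real.pi)) ∧
      (steeringOperator ρ Y).trace ≠ 0) ∧
    -- the limit
    Filter.Tendsto (fun Y => normalized (steeringOperator ρ Y))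
      (nhdsWithin P (posDefDensity (Fin 2))) (nhds P.adjugate) ∧
    P.adjugate = 1 - P :=
  ⟨fun _ hY => ⟨fun i j =>
      (continuous_absRel_steeredDeriv hρ htilt hY.1 i j).intervalIntegrable _ _,
      steeringOperator_trace_ne_zero hρ htilt hY.1⟩,
    tendsto_normalized_steeringOperator hρ htilt hP, RP1.adjugate_eq hP⟩
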